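/- Let $\mathbb{G}$ be a connected, simply connected Lie group whose Lie algebra is positively graded: $\mathfrak{g}=\bigoplus_{j=1}^s\mathfrak{g}_{w_j}$ with integers $0<w_1<\dots<w_s$ and $[\mathfrak{g}_{w_i},\mathfrak{g}_{w_j}]\subseteq\mathfrak{g}_{w_i+w_j}$ (where $\mathfrak g_w=0$ if $w$ is not one of the $w_j$). Fix a scalar product on $\mathfrak{g}$ for which the layers $\mathfrak{g}_{w_j}$ are mutually orthogonal. Identify smooth forms with $\Omega^k(\mathbb{G})=C^\infty(\mathbb{G})\otimes\bigwedge^k\mathfrak{g}^*$ through left-invariant forms, and extend the scalar product fibrewise to $\Omega^k(\mathbb G)$; orthogonality of forms is meant with respect to this $C^\infty(\mathbb G)$-valued product. A form $\alpha\in\Omega^k(\mathbb G)$ has (pure) weight $p\in\mathbb N$ if $\alpha(V_1,\dots,V_k)=0$ for all $V_a\in\mathfrak{g}_{w_{i_a}}$ with $\sum_a w_{i_a}\neq p$. Every form is the sum of its components of pure weight; $(\alpha)_q$ denotes the component of weight $q$. Let $d$ be the exterior derivative and let $d_0$ be its $C^\infty(\mathbb G)$-linear, weight-preserving part, $d_0(\sum_j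 f_j\otimes\xi_j)=\sum_j f_j\otimes d\xi_j$ with $\xi_j\in\bigwedge^\bullet\mathfrak g^*$. Let $d_0^{-1}\colon\Omega^{k+1}(\mathbb G)\to\Omega^k(\mathbb G)$ be its partial inverse: the orthogonal projection onto $\operatorname{Im}d_0$ followed by the inverse of the bijection $d_0\colon(\ker d_0)^\perp\to\operatorname{Im}d_0$ (with $d_0^{-1}=0$ on $\Omega^0(\mathbb G)$). The Rumin $k$-forms are $$E_0^k=\ker d_0\cap(\operatorname{Im}d_0)^\perp\cap\Omega^k(\mathbb{G}).$$ Put $b=-d_0^{-1}(d-d_0)$, which is nilpotent, and $$\Pi_E=\operatorname{Id}-\Pi,\qquad \Pi=(\operatorname{Id}-b)^{-1}d_0^{-1}d+d(\operatorname{Id}-b)^{-1}d_0^{-1}.$$ Proposition. Let $k\ge 1$ and let $\alpha\in E_0^{k-1}$ have weight $p$. (1) If $p$ is the maximum of the weights of nonzero $(k-1)$-forms of pure weight, then $\Pi_E\alpha=\alpha$. (2) If $d\Pi_E\alpha=\sum_{i=0}^m(d\Pi_E\alpha)_{q_i}$ with weights $q_0<q_1<\dots<q_m$, then $(d\Pi_E\alpha)_{q_0}\in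 E_0^k$. In particular, if $d\Pi_E\alpha\ne0$, its nonzero component of lowest weight is a Rumin form. -/

import Mathlib

open scoped Manifold ContDiff

noncomputable section

namespace Rumin

/-! ## Positive gradings and adapted scalar products on a real Lie algebra -/

/-- A homogeneous structure with positive integer weights on a real Lie algebra `𝔤`:
`𝔤 = ⨁ᵢ 𝔤_{wᵢ}` with `0 < w₁ < ⋯ < w_s` and `[𝔤_{wᵢ}, 𝔤_{wⱼ}] ⊆ 𝔤_{wᵢ + wⱼ}`
(the latter is `0` if `wᵢ + wⱼ` is not one of the weights). -/
structure PositiveGrading (𝔤 : Type*) [LieRing 𝔤] [LieAlgebra ℝ 𝔤] where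
  /-- the number `s` of weights -/
  s : ℕ
  /-- the weights `w₁ < ⋯ < w_s` -/
  weight : Fin s → ℕ
  weight_strictMono : StrictMono weight
  weight_pos : ∀ i, 0 < weight i
  /-- the summand `𝔤_{wᵢ}` -/
  layer : Fin s → Submodule ℝ 𝔤
  isInternal : DirectSum.IsInternal layer
  lie_mem : ∀ i j, ∀ x ∈ layer i, ∀ y ∈ layer j,
    ⁅x, y⁆ ∈ ⨆ (l : Fin s) (_ : weight l = weight i + weight j), layer l

/-- A scalar product on `𝔤` adapted to a grading: distinct layers are orthogonal. -/
structure AdaptedScalarProduct {𝔤 : Type*} [LieRing 𝔤] [LieAlgebra ℝ 𝔤]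
    (𝒱 : PositiveGrading 𝔤) where
  /-- the scalar product -/
  core : InnerProductSpace.Core ℝ 𝔤
  orthogonal : ∀ i j, i ≠ j → ∀ x ∈ 𝒱.layer i, ∀ y ∈ 𝒱.layer j, core.inner x y = 0

/-- An orthonormal basis `(X₁, …, Xₙ)` of `𝔤` adapted to the grading: each `X_a` lies in one of
the layers. -/
structure GradedOrthonormalBasis {𝔤 : Type*} [LieRing 𝔤] [LieAlgebra ℝ 𝔤]
    {𝒱 : PositiveGrading 𝔤} (sp : AdaptedScalarProduct 𝒱) (n : ℕ) where
  /-- the basis `X` -/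
  X : Module.Basis (Fin n) ℝ 𝔤
  orthonormal : ∀ a b, sp.core.inner (X a) (X b) = if a = b then 1 else 0
  /-- the index of the layer containing `X_a` -/
  layerOf : Fin n → Fin 𝒱.s
  mem_layer : ∀ a, X a ∈ 𝒱.layer (layerOf a)

/-- Every adapted scalar product on a finite-dimensional graded Lie algebra has such a basis. -/
theorem nonempty_gradedOrthonormalBasis {𝔤 : Type*} [LieRing 𝔤] [LieAlgebra ℝ 𝔤]
    [FiniteDimensional ℝ 𝔤] {𝒱 : PositiveGrading 𝔤} (sp : AdaptedScalarProduct 𝒱) :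
    Nonempty (GradedOrthonormalBasis sp (Module.finrank ℝ 𝔤)) := by
  let _ : NormedAddCommGroup 𝔤 := @InnerProductSpace.Core.toNormedAddCommGroup ℝ 𝔤 _ _ _ sp.core
  let _ : InnerProductSpace ℝ 𝔤 := InnerProductSpace.ofCore sp.core.toCore
  have hV : OrthogonalFamily ℝ (fun i => 𝒱.layer i) fun i => (𝒱.layer i).subtypeₗᵢ := by
    intro i j hij x y
    exact sp.orthogonal i j hij x x.2 y y.2
  refine ⟨⟨(𝒱.isInternal.subordinateOrthonormalBasis rfl hV).toBasis, ?_,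
    fun a => 𝒱.isInternal.subordinateOrthonormalBasisIndex rfl a hV, ?_⟩⟩
  · intro a b
    have := (orthonormal_iff_ite.mp
      (𝒱.isInternal.subordinateOrthonormalBasis rfl hV).orthonormal) a b
    simpa using this
  · intro a
    simpa using 𝒱.isInternal.subordinateOrthonormalBasis_subordinate rfl a hV

/-! ## Algebra of alternating maps on a Lie algebra

Below, `N` is either `ℝ` (left-invariant forms) or the algebra `C^∞(𝔾)` (smooth forms). -/

section Algebra

variable {𝔤 : Type*} [LieRing 𝔤] [LieAlgebra ℝ 𝔤]

/-- The bilinear map `(v, w) ↦ ι_{[v,w]} α`. -/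
def interiorLie {N : Type*} [AddCommGroup N] [Module ℝ N] {k : ℕ}
    (α : 𝔤 [⋀^Fin (k + 1)]→ₗ[ℝ] N) : 𝔤 →ₗ[ℝ] 𝔤 →ₗ[ℝ] 𝔤 [⋀^Fin k]→ₗ[ℝ] N :=
  (LieModule.toEnd ℝ 𝔤 𝔤 : 𝔤 →ₗ[ℝ] Module.End ℝ 𝔤).compr₂ α.curryLeft

/-- The algebraic (Chevalley–Eilenberg) differential
`(d₀α)(v₀, …, v_k) = ∑_{i<j} (-1)^{i+j} α([vᵢ, vⱼ], v₀, …, v̂ᵢ, …, v̂ⱼ, …, v_k)`,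
see `algD_apply` for this formula. -/
def algD {N : Type*} [AddCommGroup N] [Module ℝ N] :
    (k : ℕ) → (𝔤 [⋀^Fin k]→ₗ[ℝ] N) →ₗ[ℝ] (𝔤 [⋀^Fin (k + 1)]→ₗ[ℝ] N)
  | 0 => 0
  | _ + 1 =>
    { toFun := fun α => (-(1 / 2 : ℝ)) • AlternatingMap.alternatizeUncurryFin
        (AlternatingMap.alternatizeUncurryFinLM ∘ₗ interiorLie α)
      map_add' := fun α β => by
        have h : AlternatingMap.alternatizeUncurryFinLM ∘ₗ interiorLie (α + β) =
            AlternatingMap.alternatizeUncurryFinLM ∘ₗ interiorLie α +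
              AlternatingMap.alternatizeUncurryFinLM ∘ₗ interiorLie β := by
          rw [← LinearMap.comp_add]
          rfl
        rw [h, AlternatingMap.alternatizeUncurryFin_add, smul_add]
      map_smul' := fun c α => by
        have h : AlternatingMap.alternatizeUncurryFinLM ∘ₗ interiorLie (c • α) =
            c • (AlternatingMap.alternatizeUncurryFinLM ∘ₗ interiorLie α) := by
          rw [← LinearMap.comp_smul]
          rfl
        rw [h, AlternatingMap.alternatizeUncurryFin_smul, smul_comm, RingHom.id_apply] }

/-- The formula for the algebraic differential. A pair `i ≤ j` of `Fin (k + 1)` encodes the pair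
`i < j + 1` of positions in `Fin (k + 2)`, hence the sign in front of the sum. -/
theorem algD_apply {N : Type*} [AddCommGroup N] [Module ℝ N] {k : ℕ}
    (α : 𝔤 [⋀^Fin (k + 1)]→ₗ[ℝ] N) (v : Fin (k + 2) → 𝔤) :
    algD (k + 1) α v = -∑ i : Fin (k + 1), ∑ j ≥ i, (-1 : ℤ) ^ (i + j : ℕ) •
      α (Matrix.vecCons ⁅v i.castSucc, v j.succ⁆ (j.removeNth (i.castSucc.removeNth v))) := by
  have h : ∀ x y : 𝔤, ∀ u : Fin k → 𝔤,
      interiorLie α x y u - interiorLie α y x u = (2 : ℝ) • α (Matrix.vecCons ⁅x, y⁆ u) := by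
    intro x y u
    have h1 : interiorLie α y x = -interiorLie α x y := by
      change α.curryLeft ⁅y, x⁆ = -α.curryLeft ⁅x, y⁆
      rw [← map_neg, lie_skew]
    rw [h1, AlternatingMap.neg_apply, sub_neg_eq_add, two_smul]
    rfl
  simp only [algD, LinearMap.coe_mk, AddHom.coe_mk, AlternatingMap.smul_apply,
    AlternatingMap.alternatizeUncurryFin_alternatizeUncurryFinLM_comp_apply, h]
  simp only [Finset.smul_sum, ← Finset.sum_neg_distrib]
  refine Finset.sum_congr rfl fun i _ => Finset.sum_congr rfl fun j _ => ?_
  rw [smul_comm (-(1 / 2 : ℝ)), smul_smul]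
  norm_num

/-- The fibrewise scalar product `⟨α, β⟩_k` on alternating `k`-forms induced by the scalar
product on `𝔤`: the sum of `α(X_I) β(X_I)` over increasing multi-indices `I`, written as `1/k!`
times the sum over all multi-indices. -/
def pairing {A : Type*} [CommRing A] [Algebra ℝ A] {n : ℕ} (X : Fin n → 𝔤) {k : ℕ}
    (α β : 𝔤 [⋀^Fin k]→ₗ[ℝ] A) : A :=
  ((k.factorial : ℝ)⁻¹) • ∑ I : Fin k → Fin n, α (X ∘ I) * β (X ∘ I)

theorem pairing_comm {A : Type*} [CommRing A] [Algebra ℝ A] {n : ℕ} (X : Fin n → 𝔤) {k : ℕ}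
    (α β : 𝔤 [⋀^Fin k]→ₗ[ℝ] A) : pairing X α β = pairing X β α := by
  simp [pairing, mul_comm]

theorem pairing_sub_left {A : Type*} [CommRing A] [Algebra ℝ A] {n : ℕ} (X : Fin n → 𝔤) {k : ℕ}
    (α β γ : 𝔤 [⋀^Fin k]→ₗ[ℝ] A) :
    pairing X (α - β) γ = pairing X α γ - pairing X β γ := by
  simp [pairing, sub_mul, ← smul_sub]

theorem pairing_self_eq_zero {n : ℕ} (X : Module.Basis (Fin n) ℝ 𝔤) {k : ℕ}
    (ξ : 𝔤 [⋀^Fin k]→ₗ[ℝ] ℝ) (h : pairing X ξ ξ = 0) : ξ = 0 := by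
  refine Module.Basis.ext_alternating X fun I _ => ?_
  have hk : ((k.factorial : ℝ)⁻¹) ≠ 0 := by positivity
  have h0 := (smul_eq_zero.mp h).resolve_left hk
  rw [Finset.sum_eq_zero_iff_of_nonneg fun J _ => mul_self_nonneg _] at h0
  exact mul_self_eq_zero.mp (h0 I (Finset.mem_univ _))

/-- The scalar product on left-invariant forms as a bilinear form. -/
def pairingBilin {n : ℕ} (X : Fin n → 𝔤) (k : ℕ) : LinearMap.BilinForm ℝ (𝔤 [⋀^Fin k]→ₗ[ℝ] ℝ) :=
  LinearMap.mk₂ ℝ (pairing X)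
    (fun α β γ => by simp [pairing, add_mul, Finset.sum_add_distrib, mul_add])
    (fun c α γ => by simp [pairing, Finset.mul_sum, mul_assoc, mul_left_comm])
    (fun α β γ => by simp [pairing, Finset.sum_add_distrib, mul_add])
    (fun c α γ => by simp [pairing, Finset.mul_sum, mul_left_comm])

/-- Evaluation on the multi-indices of a basis. -/
def evalIdx {n : ℕ} (X : Fin n → 𝔤) (k : ℕ) :
    (𝔤 [⋀^Fin k]→ₗ[ℝ] ℝ) →ₗ[ℝ] ((Fin k → Fin n) → ℝ) where
  toFun ξ I := ξ (X ∘ I)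
  map_add' _ _ := rfl
  map_smul' _ _ := rfl

theorem evalIdx_injective {n : ℕ} (X : Module.Basis (Fin n) ℝ 𝔤) (k : ℕ) :
    Function.Injective (evalIdx (X : Fin n → 𝔤) k) := fun _ _ h =>
  Module.Basis.ext_alternating X fun I _ => congrFun h I

/-- Orthogonal complements in the space of left-invariant forms. -/
theorem isCompl_orthogonal {n : ℕ} (X : Module.Basis (Fin n) ℝ 𝔤) {k : ℕ}
    (W : Submodule ℝ (𝔤 [⋀^Fin k]→ₗ[ℝ] ℝ)) : IsCompl W ((pairingBilin X k).orthogonal W) := by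
  have : FiniteDimensional ℝ (𝔤 [⋀^Fin k]→ₗ[ℝ] ℝ) :=
    Module.Finite.of_injective _ (evalIdx_injective X k)
  have hr : (pairingBilin (X : Fin n → 𝔤) k).IsRefl := fun α β h => by
    change pairing X β α = 0
    rw [pairing_comm]
    exact h
  rw [LinearMap.BilinForm.isCompl_orthogonal_iff_disjoint hr, Submodule.disjoint_def]
  intro ξ hξ hξ'
  exact pairing_self_eq_zero X ξ (hξ' ξ hξ)

theorem exists_partialInverse_of_isCompl {V W : Type*} [AddCommGroup V] [Module ℝ V]
    [AddCommGroup W] [Module ℝ W] (f : V →ₗ[ℝ] W) {K : Submodule ℝ V} {R : Submodule ℝ W}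
    (hK : IsCompl (LinearMap.ker f) K) (hR : IsCompl (LinearMap.range f) R) :
    ∃ T : W →ₗ[ℝ] V, ∀ w, T w ∈ K ∧ w - f (T w) ∈ R := by
  obtain ⟨g, hg⟩ := f.rangeRestrict.exists_rightInverse_of_surjective f.range_rangeRestrict
  let P := (LinearMap.ker f).projectionOnto _ hK
  let Q := (LinearMap.range f).projectionOnto _ hR
  refine ⟨(LinearMap.id - (LinearMap.ker f).subtype ∘ₗ P) ∘ₗ g ∘ₗ Q, fun w => ⟨?_, ?_⟩⟩
  · change g (Q w) - (P (g (Q w)) : V) ∈ K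
    rw [← Submodule.ker_projectionOnto hK, LinearMap.mem_ker, map_sub,
      Submodule.projectionOnto_apply_left, sub_self]
  · have h1 : f (g (Q w)) = Q w := by
      have := congrArg Subtype.val (LinearMap.congr_fun hg (Q w))
      simpa using this
    have h2 : f (P (g (Q w))) = 0 := (P (g (Q w))).2
    change w - f (g (Q w) - P (g (Q w))) ∈ R
    rw [map_sub, h1, h2, sub_zero, ← Submodule.ker_projectionOnto hR, LinearMap.mem_ker, map_sub,
      Submodule.projectionOnto_apply_left, sub_self]

/-- The partial inverse of the algebraic differential on left-invariant forms. -/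
theorem exists_algPartialInverse {n : ℕ} (X : Module.Basis (Fin n) ℝ 𝔤) (k : ℕ) :
    ∃ T : (𝔤 [⋀^Fin (k + 1)]→ₗ[ℝ] ℝ) →ₗ[ℝ] (𝔤 [⋀^Fin k]→ₗ[ℝ] ℝ),
      ∀ η, (∀ ξ, algD k ξ = 0 → pairing X (T η) ξ = 0) ∧
        ∀ ξ, pairing X (η - algD k (T η)) (algD k ξ) = 0 := by
  obtain ⟨T, hT⟩ := exists_partialInverse_of_isCompl
    (algD k : (𝔤 [⋀^Fin k]→ₗ[ℝ] ℝ) →ₗ[ℝ] (𝔤 [⋀^Fin (k + 1)]→ₗ[ℝ] ℝ))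
    (isCompl_orthogonal X _) (isCompl_orthogonal X _)
  refine ⟨T, fun η => ⟨fun ξ hξ => ?_, fun ξ => ?_⟩⟩
  · rw [pairing_comm]
    exact (hT η).1 ξ hξ
  · rw [pairing_comm]
    exact (hT η).2 (algD k ξ) ⟨ξ, rfl⟩

namespace PositiveGrading

variable (𝒱 : PositiveGrading 𝔤)

theorem bijective_coeLinearMap :
    Function.Bijective (DirectSum.coeLinearMap 𝒱.layer) := 𝒱.isInternal

/-- The projection of `𝔤` onto the layer `𝔤_{wᵢ}` along the other layers. -/
def proj (i : Fin 𝒱.s) : 𝔤 →ₗ[ℝ] 𝔤 :=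
  (𝒱.layer i).subtype ∘ₗ DirectSum.component ℝ (Fin 𝒱.s) (fun i => 𝒱.layer i) i ∘ₗ
    (LinearEquiv.ofBijective (DirectSum.coeLinearMap 𝒱.layer) 𝒱.bijective_coeLinearMap).symm.toLinearMap

/-- `α` has pure weight `p`: it vanishes on all tuples of homogeneous vectors whose total
weight is not `p`. (The zero form has every weight.) -/
def HasWeight {N : Type*} [AddCommGroup N] [Module ℝ N] {k : ℕ} (p : ℕ)
    (α : 𝔤 [⋀^Fin k]→ₗ[ℝ] N) : Prop :=
  ∀ (i : Fin k → Fin 𝒱.s) (v : Fin k → 𝔤), (∀ a, v a ∈ 𝒱.layer (i a)) →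
    ∑ a, 𝒱.weight (i a) ≠ p → α v = 0

/-- The component `(α)_q` of weight `q` of a form `α`:
`(α)_q (v₁, …, v_k)` is the sum of `α(pr_{i₁} v₁, …, pr_{i_k} v_k)` over all choices of layers
of total weight `q`. -/
def component {N : Type*} [AddCommGroup N] [Module ℝ N] {k : ℕ} (q : ℕ)
    (α : 𝔤 [⋀^Fin k]→ₗ[ℝ] N) : 𝔤 [⋀^Fin k]→ₗ[ℝ] N where
  toMultilinearMap :=
    ∑ i : Fin k → Fin 𝒱.s with ∑ a, 𝒱.weight (i a) = q,
      α.toMultilinearMap.compLinearMap fun a => 𝒱.proj (i a)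
  map_eq_zero_of_eq' := by
    intro v a b hv hab
    simp only [MultilinearMap.toFun_eq_coe, sum_apply,
      MultilinearMap.compLinearMap_apply, AlternatingMap.coe_multilinearMap]
    refine Finset.sum_involution (fun i _ => i ∘ Equiv.swap a b) ?_ ?_ ?_ ?_
    · intro i _
      have h : (fun c => 𝒱.proj ((i ∘ Equiv.swap a b) c) (v c)) =
          (fun c => 𝒱.proj (i c) (v c)) ∘ Equiv.swap a b := by
        funext c
        have : v c = v (Equiv.swap a b c) := by
          rcases eq_or_ne c a with rfl | hca
          · simpa using hv
          rcases eq_or_ne c b with rfl | hcb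
          · simpa using hv.symm
          · rw [Equiv.swap_apply_of_ne_of_ne hca hcb]
        simp only [Function.comp_apply]
        rw [this]
      rw [h, α.map_swap _ hab, add_neg_cancel]
    · intro i _ hi h
      apply hi
      refine α.map_eq_zero_of_eq _ ?_ hab
      have : i b = i a := by simpa using congrFun h a
      simp [hv, this]
    · intro i hi
      simp only [Finset.mem_filter, Finset.mem_univ, true_and] at hi ⊢
      rw [← hi]
      exact Equiv.sum_comp (Equiv.swap a b) fun c => 𝒱.weight (i c)
    · intro i _
      funext c
      simp

end PositiveGrading

end Algebra

/-! ## Smooth forms on a Lie group -/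

section Forms

variable (E : Type*) [NormedAddCommGroup E] [NormedSpace ℝ E]
  (G : Type*) [TopologicalSpace G] [ChartedSpace E G] [Group G] [LieGroup 𝓘(ℝ, E) ∞ G]

/-- The algebra `C^∞(𝔾)`. -/
abbrev SmoothFun : Type _ := C^∞⟮𝓘(ℝ, E), G; ℝ⟯

/-- The Lie algebra `𝔤` of the Lie group: left-invariant vector fields, acting as derivations
of `C^∞(𝔾)`. -/
abbrev LieAlg : Type _ := LeftInvariantDerivation 𝓘(ℝ, E) G

/-- Smooth `k`-forms on the Lie group through the left trivialisation of the tangent bundle,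
`Ω^k(𝔾) = Hom_ℝ(⋀^k 𝔤, C^∞(𝔾)) = C^∞(𝔾) ⊗ ⋀^k 𝔤*`: for left-invariant fields `V₁, …, V_k`,
`α ![V₁, …, V_k]` is the smooth function `α(V₁, …, V_k)` on the group. -/
abbrev Form (k : ℕ) : Type _ := LieAlg E G [⋀^Fin k]→ₗ[ℝ] SmoothFun E G

variable {E G}

/-- A left-invariant vector field as a linear map on functions, `f ↦ V f`. -/
def lieDer (V : LieAlg E G) : SmoothFun E G →ₗ[ℝ] SmoothFun E G :=
  (V.toDerivation : SmoothFun E G →ₗ[ℝ] SmoothFun E G)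

/-- The map `V ↦ ((V₁, …, V_k) ↦ V(α(V₁, …, V_k)))`. -/
def formDer {k : ℕ} (α : Form E G k) : LieAlg E G →ₗ[ℝ] Form E G k where
  toFun V := (lieDer V).compAlternatingMap α
  map_add' V W := by
    ext v
    rfl
  map_smul' c V := by
    ext v
    rfl

/-- The algebraic part `d₀` of the exterior derivative, `d₀(∑ fⱼ ⊗ ξⱼ) = ∑ fⱼ ⊗ dξⱼ`. It is the
part of `d` that preserves the weight. -/
def d₀ (k : ℕ) : Form E G k →ₗ[ℝ] Form E G (k + 1) := algD k

/-- The exterior derivative, given on left-invariant vector fields by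
`dα(V₀, …, V_k) = ∑ᵢ (-1)^i Vᵢ(α(V₀, …, V̂ᵢ, …, V_k))
  + ∑_{i<j} (-1)^{i+j} α([Vᵢ, Vⱼ], V₀, …, V̂ᵢ, …, V̂ⱼ, …, V_k)`. -/
def d (k : ℕ) : Form E G k →ₗ[ℝ] Form E G (k + 1) where
  toFun α := AlternatingMap.alternatizeUncurryFin (formDer α) + d₀ k α
  map_add' α β := by
    have : formDer (α + β) = formDer α + formDer β := by
      ext V : 1
      ext v : 1
      exact map_add (lieDer V) _ _
    rw [this, AlternatingMap.alternatizeUncurryFin_add, map_add]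
    abel
  map_smul' c α := by
    have : formDer (c • α) = c • formDer α := by
      ext V : 1
      ext v : 1
      exact map_smul (lieDer V) _ _
    rw [this, AlternatingMap.alternatizeUncurryFin_smul, map_smul, RingHom.id_apply, smul_add]

theorem d_apply {k : ℕ} (α : Form E G k) (v : Fin (k + 1) → LieAlg E G) :
    d k α v = ∑ i : Fin (k + 1), (-1 : ℤ) ^ (i : ℕ) • v i (α (i.removeNth v)) + d₀ k α v := by
  change AlternatingMap.alternatizeUncurryFin (formDer α) v + d₀ k α v = _
  rw [AlternatingMap.alternatizeUncurryFin_apply]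
  rfl


variable {𝒱 : PositiveGrading (LieAlg E G)} {sp : AdaptedScalarProduct 𝒱} {n : ℕ}

/-- Orthogonality of smooth forms: the fibrewise scalar product vanishes identically. -/
def Orthogonal (F : GradedOrthonormalBasis sp n) {k : ℕ} (α β : Form E G k) : Prop :=
  pairing F.X α β = 0

/-- `Im d₀ ⊆ Ω^k`, which is `0` for `k = 0`. -/
def imD₀ : (k : ℕ) → Submodule ℝ (Form E G k)
  | 0 => ⊥
  | k + 1 => LinearMap.range (d₀ k)

/-- The space of Rumin forms `E₀^k = ker d₀ ∩ (Im d₀)^⊥ ∩ Ω^k`. -/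
def E₀ (F : GradedOrthonormalBasis sp n) (k : ℕ) : Set (Form E G k) :=
  {α | d₀ k α = 0 ∧ ∀ β ∈ imD₀ k, Orthogonal F α β}

/-- `D` inverts `d₀ : (ker d₀)^⊥ → Im d₀` after orthogonal projection onto `Im d₀`: for all `β`,
`Dβ ∈ (ker d₀)^⊥`, and `d₀(Dβ)` is the orthogonal projection of `β` onto `Im d₀`. -/
def IsPartialInverse (F : GradedOrthonormalBasis sp n) (k : ℕ)
    (D : Form E G (k + 1) →ₗ[ℝ] Form E G k) : Prop :=
  ∀ β, (∀ γ, d₀ k γ = 0 → Orthogonal F (D β) γ) ∧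
    ∀ γ, Orthogonal F (β - d₀ k (D β)) (d₀ k γ)

/-- Evaluation of a smooth form at a point of the group. -/
def evalAt (x : G) : SmoothFun E G →ₗ[ℝ] ℝ where
  toFun f := f x
  map_add' _ _ := rfl
  map_smul' _ _ := rfl

theorem evalAt_pairing (X : Fin n → LieAlg E G) {k : ℕ} (x : G) (α β : Form E G k) :
    pairing X α β x =
      pairing X ((evalAt x).compAlternatingMap α) ((evalAt x).compAlternatingMap β) := by
  change evalAt x (pairing X α β) = _
  simp only [pairing, map_smul, map_sum]
  rfl

theorem evalAt_d₀ {k : ℕ} (x : G) (α : Form E G k) :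
    (evalAt x).compAlternatingMap (d₀ k α) = algD k ((evalAt x).compAlternatingMap α) := by
  ext v
  cases k with
  | zero => rfl
  | succ k =>
    rw [algD_apply]
    change evalAt x (algD (k + 1) α v) = _
    rw [algD_apply]
    simp only [map_neg, map_sum, map_zsmul]
    rfl

theorem ext_evalAt {k : ℕ} {α β : Form E G k}
    (h : ∀ x : G, (evalAt x).compAlternatingMap α = (evalAt x).compAlternatingMap β) : α = β := by
  ext v x
  exact DFunLike.congr_fun (h x) v

theorem eq_zero_of_orthogonal_self (F : GradedOrthonormalBasis sp n) {k : ℕ} {α : Form E G k}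
    (h : Orthogonal F α α) : α = 0 := by
  refine ext_evalAt fun x => pairing_self_eq_zero F.X _ ?_
  rw [← evalAt_pairing, h]
  rfl

theorem smooth_fibrewise (F : GradedOrthonormalBasis sp n) {k l : ℕ}
    (T : (LieAlg E G [⋀^Fin k]→ₗ[ℝ] ℝ) →ₗ[ℝ] (LieAlg E G [⋀^Fin l]→ₗ[ℝ] ℝ))
    (α : Form E G k) (v : Fin l → LieAlg E G) :
    ∃ f : SmoothFun E G, ∀ x, f x = T ((evalAt x).compAlternatingMap α) v := by
  obtain ⟨S, hS⟩ := (evalIdx (F.X : Fin n → LieAlg E G) k).exists_leftInverse_of_injective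
    (LinearMap.ker_eq_bot.mpr (evalIdx_injective F.X k))
  refine ⟨∑ I : Fin k → Fin n, T (S (Pi.single I 1)) v • α (F.X ∘ I), fun x => ?_⟩
  have h1 : (evalAt x).compAlternatingMap α =
      ∑ I : Fin k → Fin n, (α (F.X ∘ I) x) • S (Pi.single I 1) := by
    have h2 := LinearMap.congr_fun hS ((evalAt x).compAlternatingMap α)
    rw [LinearMap.comp_apply, LinearMap.id_apply] at h2
    rw [← h2, LinearMap.pi_apply_eq_sum_univ S]
    refine Finset.sum_congr rfl fun I _ => ?_
    congr 2
    funext J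
    simp [Pi.single_apply, eq_comm]
  rw [h1]
  change evalAt x _ = _
  have h3 : ∀ g : (Fin k → Fin n) → (LieAlg E G [⋀^Fin l]→ₗ[ℝ] ℝ),
      (∑ I, g I) v = ∑ I, g I v := fun g =>
    map_sum ({ toFun := fun ξ => ξ v, map_zero' := rfl, map_add' := fun _ _ => rfl } :
      (LieAlg E G [⋀^Fin l]→ₗ[ℝ] ℝ) →+ ℝ) g _
  simp only [map_sum, map_smul, smul_eq_mul, h3, AlternatingMap.smul_apply]
  exact Finset.sum_congr rfl fun I _ => mul_comm (T (S (Pi.single I 1)) v) (α (F.X ∘ I) x)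

/-- Existence and uniqueness of the partial inverse of `d₀`. -/
theorem existsUnique_partialInverse (F : GradedOrthonormalBasis sp n) (k : ℕ) :
    ∃! D : Form E G (k + 1) →ₗ[ℝ] Form E G k, IsPartialInverse F k D := by
  obtain ⟨T, hT⟩ := exists_algPartialInverse F.X k
  choose f hf using smooth_fibrewise F T
  let D : Form E G (k + 1) →ₗ[ℝ] Form E G k :=
    { toFun := fun β =>
        { toFun := f β
          map_update_add' := fun v i a b => by
            ext x
            change _ = f β _ x + f β _ x
            simp only [hf]
            convert! (T ((evalAt x).compAlternatingMap β)).map_update_add v i a b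
          map_update_smul' := fun v i c a => by
            ext x
            change _ = c • f β _ x
            simp only [hf]
            convert! (T ((evalAt x).compAlternatingMap β)).map_update_smul v i c a
          map_eq_zero_of_eq' := fun v i j h hij => by
            ext x
            change f β _ x = 0
            rw [hf]
            exact AlternatingMap.map_eq_zero_of_eq _ v h hij }
      map_add' := fun β γ => by
        ext v x
        change f (β + γ) v x = f β v x + f γ v x
        simp only [hf, ← AlternatingMap.add_apply, ← map_add]
        rfl
      map_smul' := fun c β => by
        ext v x
        change f (c • β) v x = c • f β v x
        simp only [hf, ← AlternatingMap.smul_apply, ← map_smul]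
        rfl }
  have hD : ∀ x β, (evalAt x).compAlternatingMap (D β) = T ((evalAt x).compAlternatingMap β) := by
    intro x β
    ext v
    exact hf β v x
  have hIs : IsPartialInverse F k D := by
    refine fun β => ⟨fun γ hγ => ?_, fun γ => ?_⟩
    · ext x
      rw [evalAt_pairing, hD]
      refine (hT _).1 _ ?_
      rw [← evalAt_d₀, hγ]
      rfl
    · ext x
      have h : (evalAt x).compAlternatingMap (β - d₀ k (D β)) =
          (evalAt x).compAlternatingMap β - algD k (T ((evalAt x).compAlternatingMap β)) := by
        rw [← hD, ← evalAt_d₀]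
        rfl
      rw [evalAt_pairing, h, evalAt_d₀]
      exact (hT _).2 _
  refine ⟨D, hIs, fun D' hD' => ?_⟩
  · ext1 β
    have h1 : d₀ k (D' β - D β) = 0 := by
      refine eq_zero_of_orthogonal_self F ?_
      have h2 : d₀ k (D' β - D β) = (β - d₀ k (D β)) - (β - d₀ k (D' β)) := by
        rw [map_sub]
        abel
      have h3 := hIs β
      have h4 := hD' β
      rw [Orthogonal]
      nth_rw 1 [h2]
      rw [pairing_sub_left, h3.2, h4.2, sub_zero]
    refine sub_eq_zero.mp (eq_zero_of_orthogonal_self F ?_)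
    have h3 := (hIs β).1 _ h1
    have h4 := (hD' β).1 _ h1
    rw [Orthogonal] at h3 h4 ⊢
    rw [pairing_sub_left, h3, h4, sub_zero]

/-- The partial inverse `d₀⁻¹ = d₀⁻¹ pr_{Im d₀} : Ω^{k+1} → Ω^k`. -/
def d₀Inv (F : GradedOrthonormalBasis sp n) (k : ℕ) : Form E G (k + 1) →ₗ[ℝ] Form E G k :=
  (existsUnique_partialInverse F k).choose

theorem isPartialInverse_d₀Inv (F : GradedOrthonormalBasis sp n) (k : ℕ) :
    IsPartialInverse F k (d₀Inv F k) :=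
  (existsUnique_partialInverse F k).choose_spec.1

/-- The degree preserving operator `b = d₀⁻¹ d₀ - d₀⁻¹ d = -d₀⁻¹ (d - d₀)` on `Ω^k`. -/
def b (F : GradedOrthonormalBasis sp n) (k : ℕ) : Module.End ℝ (Form E G k) :=
  d₀Inv F k ∘ₗ d₀ k - d₀Inv F k ∘ₗ d k

/-- The operator `(Id - b)⁻¹` on `Ω^k` (`b` is nilpotent, so `Id - b` is a unit). -/
def invOneSubB (F : GradedOrthonormalBasis sp n) (k : ℕ) : Module.End ℝ (Form E G k) :=
  Ring.inverse (1 - b F k)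

/-- The projection `Π_F = Π = (Id - b)⁻¹ d₀⁻¹ d + d (Id - b)⁻¹ d₀⁻¹` on `Ω^k`; the second summand
is `0` for `k = 0`. -/
def PiF (F : GradedOrthonormalBasis sp n) : (k : ℕ) → Module.End ℝ (Form E G k)
  | 0 => invOneSubB F 0 ∘ₗ d₀Inv F 0 ∘ₗ d 0
  | k + 1 => invOneSubB F (k + 1) ∘ₗ d₀Inv F (k + 1) ∘ₗ d (k + 1) +
      d k ∘ₗ invOneSubB F k ∘ₗ d₀Inv F k

/-- The projection `Π_E = Id - Π` on `Ω^k`. -/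
def PiE (F : GradedOrthonormalBasis sp n) (k : ℕ) : Module.End ℝ (Form E G k) :=
  LinearMap.id - PiF F k

end Forms

end Rumin

end

noncomputable section

namespace Rumin

/-! ## Cartan calculus for smooth forms and `d ∘ d = 0` -/

/-! ### Contracting an alternatized map with a vector. -/

section Uncurry

variable {R M N : Type*} [CommRing R] [AddCommGroup M] [Module R M] [AddCommGroup N] [Module R N]

/-! Both `d₀` and `d₀⁻¹` preserve weights, the latter because forms of different weights are
orthogonal. The remainder `d - d₀` strictly raises weights, since it differentiates along fields of
positive weight. Weights in a fixed degree are bounded, so `b` is nilpotent and `Id - b` is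
invertible.

For a Rumin form `α` one has `d₀⁻¹α = 0`, hence `Π_E α = α - (Id - b)⁻¹ d₀⁻¹ dα`. In (1), `d₀α = 0`
gives `dα` only weights above `p`; so does `d₀⁻¹ dα`, which has the degree of `α` and therefore
vanishes.

For (2), put `β = d Π_E α`. Then `dβ = 0` (`d_d`) and `d₀⁻¹β = 0`, that is, `β ⊥ Im d₀`
(`d₀Inv_d_PiE`, resting on `d₀Inv_d_invOneSubB_d₀Inv`). In the lowest weight `q` the equation `dβ =
0` reads `d₀(β)_q = 0`, and orthogonality to the graded space `Im d₀` passes to each component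
(`component_mem_E₀`).

As `d` is given by a formula on left-invariant fields, `d ∘ d = 0` is derived from Cartan calculus
by induction on the degree. -/

theorem ext_curryLeft {k : ℕ} {α β : M [⋀^Fin (k + 1)]→ₗ[R] N}
    (h : ∀ x, α.curryLeft x = β.curryLeft x) : α = β := by
  ext v
  have := DFunLike.congr_fun (h (v 0)) (Matrix.vecTail v)
  rw [AlternatingMap.curryLeft_apply_apply, AlternatingMap.curryLeft_apply_apply] at this
  rwa [show Matrix.vecCons (v 0) (Matrix.vecTail v) = v from Matrix.cons_head_tail v] at this

theorem curryLeft_alternatizeUncurryFin_zero (f : M →ₗ[R] M [⋀^Fin 0]→ₗ[R] N) (x : M) :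
    (AlternatingMap.alternatizeUncurryFin f).curryLeft x = f x := by
  ext v
  rw [AlternatingMap.curryLeft_apply_apply, AlternatingMap.alternatizeUncurryFin_apply]
  simp

/-- The term `i = 0` of the alternating sum feeds `x` to `f`; in every other term `x` stays in the
first slot of the value of `f`, and the index shift flips the sign. This recursion underlies all
contraction formulas below. -/
theorem curryLeft_alternatizeUncurryFin_succ {k : ℕ} (f : M →ₗ[R] M [⋀^Fin (k + 1)]→ₗ[R] N)
    (x : M) :
    (AlternatingMap.alternatizeUncurryFin f).curryLeft x =
      f x - AlternatingMap.alternatizeUncurryFin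
        ((AlternatingMap.curryLeftLinearMap (R := R) (M := M) (N := N)).flip x ∘ₗ f) := by
  ext v
  rw [AlternatingMap.curryLeft_apply_apply, AlternatingMap.alternatizeUncurryFin_apply,
    Fin.sum_univ_succ, AlternatingMap.sub_apply, AlternatingMap.alternatizeUncurryFin_apply,
    sub_eq_add_neg, ← Finset.sum_neg_distrib]
  congr 1
  · simp [Fin.removeNth_zero]
  · refine Finset.sum_congr rfl fun i _ => ?_
    have h : i.succ.removeNth (Matrix.vecCons x v) = Matrix.vecCons x (i.removeNth v) := by
      funext j
      refine Fin.cases ?_ (fun j => ?_) j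
      · simp [Fin.removeNth]
      · simp [Fin.removeNth]
    rw [h, Fin.val_succ, pow_succ, mul_neg_one, neg_smul]
    rfl

theorem curryLeft_sub {k : ℕ} (α β : M [⋀^Fin (k + 1)]→ₗ[R] N) (x : M) :
    (α - β).curryLeft x = α.curryLeft x - β.curryLeft x :=
  rfl

/-- Polarization of `curryLeft_same` at `x + y`. -/
theorem curryLeft_swap {k : ℕ} (α : M [⋀^Fin (k + 2)]→ₗ[R] N) (x y : M) :
    (α.curryLeft x).curryLeft y = -(α.curryLeft y).curryLeft x := by
  have h := α.curryLeft_same (x + y)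
  have h2 : (α.curryLeft (x + y)).curryLeft (x + y) =
      (α.curryLeft x).curryLeft x + (α.curryLeft y).curryLeft x +
        ((α.curryLeft x).curryLeft y + (α.curryLeft y).curryLeft y) := by
    rw [map_add, map_add, AlternatingMap.curryLeft_add, LinearMap.add_apply, LinearMap.add_apply]
  rw [h2, α.curryLeft_same, α.curryLeft_same] at h
  rw [eq_neg_iff_add_eq_zero]
  rw [← h]
  abel

theorem alternatizeUncurryFin_neg {k : ℕ} (f : M →ₗ[R] M [⋀^Fin k]→ₗ[R] N) :
    AlternatingMap.alternatizeUncurryFin (-f) = -AlternatingMap.alternatizeUncurryFin f :=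
  map_neg (AlternatingMap.alternatizeUncurryFinLM (R := R) (M := M) (N := N)) f

end Uncurry

/-! ### Contracting the algebraic differential. -/

section AlgD

variable {𝔤 N : Type*} [LieRing 𝔤] [LieAlgebra ℝ 𝔤] [AddCommGroup N] [Module ℝ N]

theorem interiorLie_swap {k : ℕ} (α : 𝔤 [⋀^Fin (k + 1)]→ₗ[ℝ] N) (x y : 𝔤) :
    interiorLie α y x = -interiorLie α x y := by
  change α.curryLeft ⁅y, x⁆ = -α.curryLeft ⁅x, y⁆
  rw [← map_neg, lie_skew]

/-- Algebraic Cartan formula `ι_x d₀ = L_x - d₀ ι_x`, with `L_x` the coadjoint action. The bracket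
term with `x` arises twice, from either slot of the antisymmetric `interiorLie α`, which cancels the
factor `1 / 2` in `algD`. -/
theorem curryLeft_algD {k : ℕ} (x : 𝔤) (α : 𝔤 [⋀^Fin (k + 1)]→ₗ[ℝ] N) :
    (algD (k + 1) α).curryLeft x =
      -AlternatingMap.alternatizeUncurryFin (interiorLie α x) - algD k (α.curryLeft x) := by
  change ((-(1 / 2 : ℝ)) • AlternatingMap.alternatizeUncurryFin
        (AlternatingMap.alternatizeUncurryFinLM ∘ₗ interiorLie α)).curryLeft x = _
  rw [AlternatingMap.curryLeft_smul, LinearMap.smul_apply, curryLeft_alternatizeUncurryFin_succ,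
    LinearMap.comp_apply, AlternatingMap.alternatizeUncurryFinLM_apply]
  cases k with
  | zero =>
    have h : AlternatingMap.curryLeftLinearMap.flip x ∘ₗ
        (AlternatingMap.alternatizeUncurryFinLM ∘ₗ interiorLie α) = -interiorLie α x := by
      ext1 y
      have h1 := curryLeft_alternatizeUncurryFin_zero (interiorLie α y) x
      rw [interiorLie_swap α x y] at h1
      exact h1
    have h0 : algD 0 (α.curryLeft x) = 0 := rfl
    rw [h, h0, alternatizeUncurryFin_neg]
    module
  | succ k =>
    have h : AlternatingMap.curryLeftLinearMap.flip x ∘ₗ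
        (AlternatingMap.alternatizeUncurryFinLM ∘ₗ interiorLie α) = -interiorLie α x +
          AlternatingMap.alternatizeUncurryFinLM ∘ₗ interiorLie (α.curryLeft x) := by
      ext1 y
      have h2 := curryLeft_alternatizeUncurryFin_succ (interiorLie α y) x
      have h1 : AlternatingMap.curryLeftLinearMap.flip x ∘ₗ interiorLie α y =
          -interiorLie (α.curryLeft x) y := by
        ext1 z
        exact curryLeft_swap α _ _
      rw [h1, interiorLie_swap α x y, alternatizeUncurryFin_neg, sub_neg_eq_add] at h2
      exact h2
    have h0 : algD (k + 1) (α.curryLeft x) = (-(1 / 2 : ℝ)) • AlternatingMap.alternatizeUncurryFin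
        (AlternatingMap.alternatizeUncurryFinLM ∘ₗ interiorLie (α.curryLeft x)) := rfl
    rw [h, h0, AlternatingMap.alternatizeUncurryFin_add, alternatizeUncurryFin_neg]
    module

end AlgD

/-! ### Lie derivatives along left-invariant fields. -/

section Cartan

variable {E : Type*} [NormedAddCommGroup E] [NormedSpace ℝ E]
  {G : Type*} [TopologicalSpace G] [ChartedSpace E G] [Group G] [LieGroup 𝓘(ℝ, E) ∞ G]

/-- The Lie derivative of a form along a left-invariant vector field. -/
def lieDeriv (V : LieAlg E G) : (k : ℕ) → Form E G k →ₗ[ℝ] Form E G k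
  | 0 =>
    { toFun := fun α => (lieDer V).compAlternatingMap α
      map_add' := fun α β => by ext1 v; exact map_add (lieDer V) _ _
      map_smul' := fun c α => by ext1 v; exact map_smul (lieDer V) _ _ }
  | _ + 1 =>
    { toFun := fun α => (lieDer V).compAlternatingMap α -
        AlternatingMap.alternatizeUncurryFin (interiorLie α V)
      map_add' := fun α β => by
        have h : interiorLie (α + β) V = interiorLie α V + interiorLie β V := rfl
        have h' : (lieDer V).compAlternatingMap (α + β) =
            (lieDer V).compAlternatingMap α + (lieDer V).compAlternatingMap β := by
          ext1 v; exact map_add (lieDer V) _ _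
        rw [h, h', AlternatingMap.alternatizeUncurryFin_add]
        abel
      map_smul' := fun c α => by
        have h : interiorLie (c • α) V = c • interiorLie α V := rfl
        have h' : (lieDer V).compAlternatingMap (c • α) =
            c • (lieDer V).compAlternatingMap α := by
          ext1 v; exact map_smul (lieDer V) _ _
        rw [h, h', AlternatingMap.alternatizeUncurryFin_smul, smul_sub, RingHom.id_apply] }

/-- The relation `[L_V, ι_W] = ι_{[V,W]}`; it drives the inductions on the degree. -/
theorem curryLeft_lieDeriv {k : ℕ} (V W : LieAlg E G) (α : Form E G (k + 1)) :
    (lieDeriv V (k + 1) α).curryLeft W =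
      lieDeriv V k (α.curryLeft W) - α.curryLeft ⁅V, W⁆ := by
  change ((lieDer V).compAlternatingMap α -
        AlternatingMap.alternatizeUncurryFin (interiorLie α V)).curryLeft W = _
  rw [curryLeft_sub]
  cases k with
  | zero =>
    rw [curryLeft_alternatizeUncurryFin_zero]
    rfl
  | succ k =>
    rw [curryLeft_alternatizeUncurryFin_succ]
    have h : AlternatingMap.curryLeftLinearMap.flip W ∘ₗ interiorLie α V =
        -interiorLie (α.curryLeft W) V := by
      ext1 Z
      exact curryLeft_swap α _ _
    rw [h, alternatizeUncurryFin_neg, sub_neg_eq_add]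
    change _ = (lieDer V).compAlternatingMap (α.curryLeft W) -
        AlternatingMap.alternatizeUncurryFin (interiorLie (α.curryLeft W) V) - _
    change (lieDer V).compAlternatingMap (α.curryLeft W) - (α.curryLeft ⁅V, W⁆ + _) = _
    abel

/-- In degree `0` this is the definition of the bracket of derivations. Contraction with `Z` lowers
the degree, and the leftover bracket terms cancel by the Jacobi identity. -/
theorem lieDeriv_lie {k : ℕ} (V W : LieAlg E G) (α : Form E G k) :
    lieDeriv ⁅V, W⁆ k α = lieDeriv V k (lieDeriv W k α) - lieDeriv W k (lieDeriv V k α) := by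
  induction k with
  | zero => ext1 v; rfl
  | succ k ih =>
    refine ext_curryLeft fun Z => ?_
    simp only [curryLeft_sub, curryLeft_lieDeriv, ih, map_sub]
    rw [leibniz_lie V W Z, map_add]
    have h : ⁅⁅V, W⁆, Z⁆ = ⁅V, ⁅W, Z⁆⁆ - ⁅W, ⁅V, Z⁆⁆ := lie_lie V W Z
    rw [leibniz_lie V W Z, add_sub_cancel_right] at h
    abel

theorem curryLeft_d_zero (V : LieAlg E G) (α : Form E G 0) :
    (d 0 α).curryLeft V = lieDeriv V 0 α := by
  change (AlternatingMap.alternatizeUncurryFin (formDer α) + 0).curryLeft V = _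
  rw [add_zero, curryLeft_alternatizeUncurryFin_zero]
  rfl

/-- Cartan's formula `ι_V d = L_V - d ι_V`. -/
theorem curryLeft_d_succ {k : ℕ} (V : LieAlg E G) (α : Form E G (k + 1)) :
    (d (k + 1) α).curryLeft V = lieDeriv V (k + 1) α - d k (α.curryLeft V) := by
  change (AlternatingMap.alternatizeUncurryFin (formDer α)).curryLeft V +
    (d₀ (k + 1) α).curryLeft V = (lieDer V).compAlternatingMap α -
        AlternatingMap.alternatizeUncurryFin (interiorLie α V) -
      (AlternatingMap.alternatizeUncurryFin (formDer (α.curryLeft V)) + d₀ k (α.curryLeft V))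
  rw [show (d₀ (k + 1) α).curryLeft V = -AlternatingMap.alternatizeUncurryFin (interiorLie α V) -
    d₀ k (α.curryLeft V) from curryLeft_algD V α, curryLeft_alternatizeUncurryFin_succ]
  change (lieDer V).compAlternatingMap α -
    AlternatingMap.alternatizeUncurryFin (formDer (α.curryLeft V)) + _ = _
  abel

theorem d_lieDeriv {k : ℕ} (V : LieAlg E G) (α : Form E G k) :
    d k (lieDeriv V k α) = lieDeriv V (k + 1) (d k α) := by
  induction k with
  | zero =>
    refine ext_curryLeft fun W => ?_
    rw [curryLeft_d_zero, curryLeft_lieDeriv, curryLeft_d_zero, curryLeft_d_zero, lieDeriv_lie]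
    abel
  | succ k ih =>
    refine ext_curryLeft fun W => ?_
    rw [curryLeft_d_succ, curryLeft_lieDeriv, curryLeft_lieDeriv, curryLeft_d_succ,
      curryLeft_d_succ, lieDeriv_lie, map_sub, map_sub, ih]
    abel

/-- By Cartan's formula `ι_V d d = L_V d - d L_V + d d ι_V`; the first two terms cancel by
`d_lieDeriv`, and the last is the induction hypothesis (absent in degree `0`). -/
theorem d_d {k : ℕ} (α : Form E G k) : d (k + 1) (d k α) = 0 := by
  induction k with
  | zero =>
    refine ext_curryLeft fun V => ?_
    rw [curryLeft_d_succ, curryLeft_d_zero, d_lieDeriv, sub_self]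
    rfl
  | succ k ih =>
    refine ext_curryLeft fun V => ?_
    rw [curryLeft_d_succ, curryLeft_d_succ, map_sub, ih, d_lieDeriv, sub_zero, sub_self]
    rfl

end Cartan

end Rumin

end

noncomputable section

namespace Rumin

/-! ## Weights of alternating maps -/

theorem alternatingMap_sum_apply {R M N ι κ : Type*} [CommRing R] [AddCommGroup M] [Module R M]
    [AddCommGroup N] [Module R N] (s : Finset κ) (f : κ → M [⋀^ι]→ₗ[R] N) (v : ι → M) :
    (∑ j ∈ s, f j) v = ∑ j ∈ s, f j v :=
  map_sum ({ toFun := fun α => α v, map_zero' := rfl, map_add' := fun _ _ => rfl } :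
    (M [⋀^ι]→ₗ[R] N) →+ N) f s

namespace PositiveGrading

variable {𝔤 : Type*} [LieRing 𝔤] [LieAlgebra ℝ 𝔤] (𝒱 : PositiveGrading 𝔤)
  {N : Type*} [AddCommGroup N] [Module ℝ N]

/-- All weights occurring in `α` lie in `S`. -/
def WeightsIn {k : ℕ} (S : Set ℕ) (α : 𝔤 [⋀^Fin k]→ₗ[ℝ] N) : Prop :=
  ∀ (i : Fin k → Fin 𝒱.s) (v : Fin k → 𝔤), (∀ a, v a ∈ 𝒱.layer (i a)) →
    ∑ a, 𝒱.weight (i a) ∉ S → α v = 0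

variable {𝒱}

theorem hasWeight_iff_weightsIn {k p : ℕ} {α : 𝔤 [⋀^Fin k]→ₗ[ℝ] N} :
    𝒱.HasWeight p α ↔ 𝒱.WeightsIn {p} α :=
  Iff.rfl

namespace WeightsIn

variable {k : ℕ} {S T : Set ℕ} {α β : 𝔤 [⋀^Fin k]→ₗ[ℝ] N}

theorem mono (h : 𝒱.WeightsIn S α) (hST : S ⊆ T) : 𝒱.WeightsIn T α :=
  fun i v hv hi => h i v hv fun hS => hi (hST hS)

theorem inter (h : 𝒱.WeightsIn S α) (h' : 𝒱.WeightsIn T α) : 𝒱.WeightsIn (S ∩ T) α := by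
  intro i v hv hi
  by_cases hS : ∑ a, 𝒱.weight (i a) ∈ S
  · exact h' i v hv fun hT => hi ⟨hS, hT⟩
  · exact h i v hv hS

theorem zero : 𝒱.WeightsIn S (0 : 𝔤 [⋀^Fin k]→ₗ[ℝ] N) := fun _ _ _ _ => rfl

theorem neg (h : 𝒱.WeightsIn S α) : 𝒱.WeightsIn S (-α) := by
  intro i v hv hi
  rw [AlternatingMap.neg_apply, h i v hv hi, neg_zero]

theorem add (h : 𝒱.WeightsIn S α) (h' : 𝒱.WeightsIn S β) : 𝒱.WeightsIn S (α + β) := by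
  intro i v hv hi
  rw [AlternatingMap.add_apply, h i v hv hi, h' i v hv hi, add_zero]

theorem sum {ι : Type*} (s : Finset ι) {f : ι → 𝔤 [⋀^Fin k]→ₗ[ℝ] N}
    (h : ∀ j ∈ s, 𝒱.WeightsIn S (f j)) : 𝒱.WeightsIn S (∑ j ∈ s, f j) :=
  Finset.sum_induction f (𝒱.WeightsIn S) (fun _ _ => add) zero h

/-- The weights of alternating maps of degree `k` are bounded. -/
theorem sum_weight_lt (k : ℕ) (i : Fin k → Fin 𝒱.s) :
    ∑ a, 𝒱.weight (i a) < k * (∑ j, 𝒱.weight j) + 1 := by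
  refine Nat.lt_succ_of_le ?_
  calc ∑ a, 𝒱.weight (i a) ≤ ∑ _a : Fin k, ∑ j, 𝒱.weight j :=
        Finset.sum_le_sum fun a _ =>
          Finset.single_le_sum (f := 𝒱.weight) (fun _ _ => Nat.zero_le _) (Finset.mem_univ (i a))
    _ = _ := by simp

/-- The algebraic differential preserves weights. -/
theorem algD (h : 𝒱.WeightsIn S α) : 𝒱.WeightsIn S (Rumin.algD k α) := by
  cases k with
  | zero => exact zero
  | succ k =>
    intro i v hv hi
    rw [algD_apply, neg_eq_zero]
    refine Finset.sum_eq_zero fun a _ => Finset.sum_eq_zero fun c hc => ?_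
    have hac : a ≤ c := by simpa using hc
    -- After position `a` is deleted, index `c ≥ a` refers to the original position `c + 1`.
    have hsucc : a.castSucc.succAbove c = c.succ :=
      Fin.succAbove_of_le_castSucc _ _ (by simpa using hac)
    have hsum : ∑ e, 𝒱.weight (i e) = 𝒱.weight (i a.castSucc) + 𝒱.weight (i c.succ) +
        ∑ e, 𝒱.weight (c.removeNth (a.castSucc.removeNth i) e) := by
      rw [Fin.sum_univ_succAbove _ a.castSucc, Fin.sum_univ_succAbove _ c, hsucc, add_assoc]
      rfl
    suffices hz : α (Matrix.vecCons ⁅v a.castSucc, v c.succ⁆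
        (c.removeNth (a.castSucc.removeNth v))) = 0 by rw [hz, smul_zero]
    have hlie := 𝒱.lie_mem _ _ _ (hv a.castSucc) _ (hv c.succ)
    by_cases hl : ∃ l, 𝒱.weight l = 𝒱.weight (i a.castSucc) + 𝒱.weight (i c.succ)
    · obtain ⟨l, hl⟩ := hl
      have hmem : ⁅v a.castSucc, v c.succ⁆ ∈ 𝒱.layer l := by
        refine (iSup₂_le fun l' hl' => ?_ : _ ≤ 𝒱.layer l) hlie
        rw [𝒱.weight_strictMono.injective (hl'.trans hl.symm)]
      -- The bracket replaces two vectors by one of their combined weight, so the total weight is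
      -- unchanged.
      refine h (Matrix.vecCons l (c.removeNth (a.castSucc.removeNth i))) _ ?_ ?_
      · refine Fin.cases ?_ fun e => ?_
        · simpa using hmem
        · exact hv _
      · rw [Fin.sum_univ_succ]
        simpa [hl, ← hsum] using hi
    · have hz : ⁅v a.castSucc, v c.succ⁆ = 0 := by
        rw [← Submodule.mem_bot ℝ]
        exact (iSup₂_le fun l' hl' => absurd ⟨l', hl'⟩ hl : _ ≤ (⊥ : Submodule ℝ 𝔤)) hlie
      exact α.map_coord_zero 0 (by simpa using hz)

end WeightsIn

theorem proj_apply_of_mem {i : Fin 𝒱.s} {x : 𝔤} (hx : x ∈ 𝒱.layer i) (j : Fin 𝒱.s) :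
    𝒱.proj j x = if i = j then x else 0 := by
  have h : (LinearEquiv.ofBijective (DirectSum.coeLinearMap 𝒱.layer)
      𝒱.bijective_coeLinearMap).symm x = DirectSum.lof ℝ _ (fun i => 𝒱.layer i) i ⟨x, hx⟩ := by
    rw [LinearEquiv.symm_apply_eq]
    simp
  change ((DirectSum.component ℝ (Fin 𝒱.s) (fun i => 𝒱.layer i) j
    ((LinearEquiv.ofBijective (DirectSum.coeLinearMap 𝒱.layer)
      𝒱.bijective_coeLinearMap).symm x) : 𝒱.layer j) : 𝔤) = _
  rw [h]
  split_ifs with hij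
  · subst hij
    rw [DirectSum.component.lof_self]
  · rw [DirectSum.component.of, dif_neg hij]
    rfl

/-- On homogeneous vectors only the choice of layers `j = i` survives in the defining sum. -/
theorem component_apply_of_mem {k : ℕ} (q : ℕ) (α : 𝔤 [⋀^Fin k]→ₗ[ℝ] N) (i : Fin k → Fin 𝒱.s)
    (v : Fin k → 𝔤) (hv : ∀ a, v a ∈ 𝒱.layer (i a)) :
    𝒱.component q α v = if ∑ a, 𝒱.weight (i a) = q then α v else 0 := by
  change (∑ j : Fin k → Fin 𝒱.s with ∑ a, 𝒱.weight (j a) = q,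
      α.toMultilinearMap.compLinearMap fun a => 𝒱.proj (j a)) v = _
  rw [sum_apply]
  have h : ∀ j : Fin k → Fin 𝒱.s, (α.toMultilinearMap.compLinearMap fun a => 𝒱.proj (j a)) v =
      if j = i then α v else 0 := by
    intro j
    change α (fun a => 𝒱.proj (j a) (v a)) = _
    split_ifs with hj
    · subst hj
      congr 1
      funext a
      rw [proj_apply_of_mem (hv a), if_pos rfl]
    · obtain ⟨a, ha⟩ := Function.ne_iff.mp hj
      exact α.map_coord_zero a (by rw [proj_apply_of_mem (hv a), if_neg (Ne.symm ha)])
  simp only [h]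
  rw [Finset.sum_ite_eq']
  simp

theorem weightsIn_component {k : ℕ} (q : ℕ) (α : 𝔤 [⋀^Fin k]→ₗ[ℝ] N) :
    𝒱.WeightsIn {q} (𝒱.component q α) := fun i v hv hi => by
  rw [component_apply_of_mem q α i v hv]
  exact if_neg hi

/-- The lowest weight can be split off. -/
theorem WeightsIn.sub_component {k q : ℕ} {α : 𝔤 [⋀^Fin k]→ₗ[ℝ] N}
    (h : 𝒱.WeightsIn (Set.Ici q) α) : 𝒱.WeightsIn (Set.Ici (q + 1)) (α - 𝒱.component q α) := by
  intro i v hv hi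
  rw [AlternatingMap.sub_apply, component_apply_of_mem q α i v hv]
  split_ifs with hq
  · exact sub_self _
  · rw [sub_zero]
    refine h i v hv ?_
    simp only [Set.mem_Ici] at hi ⊢
    omega

/-! ### Splitting by weight and orthogonality of different weights. -/

variable {sp : AdaptedScalarProduct 𝒱} {n : ℕ}

theorem eq_of_forall_homogeneous (F : GradedOrthonormalBasis sp n)
    {k : ℕ} {α β : 𝔤 [⋀^Fin k]→ₗ[ℝ] N}
    (h : ∀ (i : Fin k → Fin 𝒱.s) (v : Fin k → 𝔤), (∀ a, v a ∈ 𝒱.layer (i a)) → α v = β v) :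
    α = β :=
  Module.Basis.ext_alternating F.X fun I _ => h (F.layerOf ∘ I) _ fun a => F.mem_layer (I a)

theorem WeightsIn.eq_zero (F : GradedOrthonormalBasis sp n)
    {k : ℕ} {S : Set ℕ} {α : 𝔤 [⋀^Fin k]→ₗ[ℝ] N} (h : 𝒱.WeightsIn S α)
    (hS : ∀ i : Fin k → Fin 𝒱.s, ∑ a, 𝒱.weight (i a) ∉ S) : α = 0 :=
  eq_of_forall_homogeneous F fun i v hv => h i v hv (hS i)

theorem exists_weightsIn_add_compl (F : GradedOrthonormalBasis sp n)
    {k : ℕ} (S : Set ℕ) (α : 𝔤 [⋀^Fin k]→ₗ[ℝ] N) :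
    ∃ β γ, 𝒱.WeightsIn S β ∧ 𝒱.WeightsIn Sᶜ γ ∧ α = β + γ := by
  classical
  let t := Finset.range (k * (∑ j, 𝒱.weight j) + 1)
  refine ⟨∑ q ∈ t with q ∈ S, 𝒱.component q α, ∑ q ∈ t with q ∉ S, 𝒱.component q α,
    WeightsIn.sum _ fun q hq => (weightsIn_component q α).mono ?_,
    WeightsIn.sum _ fun q hq => (weightsIn_component q α).mono ?_, ?_⟩
  · simpa using (Finset.mem_filter.mp hq).2
  · simpa using (Finset.mem_filter.mp hq).2
  · rw [Finset.sum_filter_add_sum_filter_not]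
    refine eq_of_forall_homogeneous F fun i v hv => ?_
    rw [alternatingMap_sum_apply]
    simp only [component_apply_of_mem _ α i v hv]
    rw [Finset.sum_ite_eq, if_pos (Finset.mem_range.mpr (WeightsIn.sum_weight_lt k i))]

/-- The weight of each multi-index of the adapted basis lies in `S` or in `Sᶜ`, so one factor of
every summand vanishes. -/
theorem pairing_eq_zero_of_weightsIn_compl (F : GradedOrthonormalBasis sp n)
    {A : Type*} [CommRing A] [Algebra ℝ A] {k : ℕ}
    {S : Set ℕ} {α β : 𝔤 [⋀^Fin k]→ₗ[ℝ] A} (h : 𝒱.WeightsIn S α) (h' : 𝒱.WeightsIn Sᶜ β) :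
    pairing F.X α β = 0 := by
  rw [pairing, Finset.sum_eq_zero, smul_zero]
  intro I _
  by_cases hS : ∑ a, 𝒱.weight (F.layerOf (I a)) ∈ S
  · rw [h' (F.layerOf ∘ I) (F.X ∘ I) (fun a => F.mem_layer (I a)) (by simpa using hS), mul_zero]
  · rw [h (F.layerOf ∘ I) (F.X ∘ I) (fun a => F.mem_layer (I a)) hS, zero_mul]

end PositiveGrading

end Rumin

end

noncomputable section

namespace Rumin

/-! ## The partial inverse of `d₀` and the projection `Π_E` -/

theorem pairing_add_left {𝔤 A : Type*} [LieRing 𝔤] [LieAlgebra ℝ 𝔤] [CommRing A] [Algebra ℝ A]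
    {n : ℕ} (X : Fin n → 𝔤) {k : ℕ} (α β γ : 𝔤 [⋀^Fin k]→ₗ[ℝ] A) :
    pairing X (α + β) γ = pairing X α γ + pairing X β γ := by
  simp [pairing, add_mul, Finset.sum_add_distrib]

theorem pairing_add_right {𝔤 A : Type*} [LieRing 𝔤] [LieAlgebra ℝ 𝔤] [CommRing A] [Algebra ℝ A]
    {n : ℕ} (X : Fin n → 𝔤) {k : ℕ} (α β γ : 𝔤 [⋀^Fin k]→ₗ[ℝ] A) :
    pairing X α (β + γ) = pairing X α β + pairing X α γ := by
  simp [pairing, mul_add, Finset.sum_add_distrib]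

section Forms

open PositiveGrading

variable {E : Type*} [NormedAddCommGroup E] [NormedSpace ℝ E]
  {G : Type*} [TopologicalSpace G] [ChartedSpace E G] [Group G] [LieGroup 𝓘(ℝ, E) ∞ G]
  {𝒱 : PositiveGrading (LieAlg E G)} {sp : AdaptedScalarProduct 𝒱} {n : ℕ}
  (F : GradedOrthonormalBasis sp n) {k : ℕ}

theorem eq_zero_of_d₀_eq_zero {α : Form E G k} (h : d₀ k α = 0)
    (h' : ∀ γ, d₀ k γ = 0 → Orthogonal F α γ) : α = 0 :=
  eq_zero_of_orthogonal_self F (h' α h)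

/-- If `β ⊥ Im d₀`, then `d₀ d₀⁻¹ β` is orthogonal to itself, and `d₀` is injective on `(ker d₀)^⊥`.
-/
theorem d₀Inv_eq_zero_iff (β : Form E G (k + 1)) :
    d₀Inv F k β = 0 ↔ ∀ γ, Orthogonal F β (d₀ k γ) := by
  obtain ⟨h1, h2⟩ := isPartialInverse_d₀Inv F k β
  constructor
  · intro h γ
    have := h2 γ
    rwa [h, map_zero, sub_zero] at this
  · intro h
    refine eq_zero_of_d₀_eq_zero F (eq_zero_of_orthogonal_self F ?_) h1
    have h3 := h2 (d₀Inv F k β)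
    rwa [Orthogonal, pairing_sub_left, h, zero_sub, neg_eq_zero] at h3

theorem d₀Inv_d₀_d₀Inv (β : Form E G (k + 1)) :
    d₀Inv F k (d₀ k (d₀Inv F k β)) = d₀Inv F k β := by
  refine Eq.symm (sub_eq_zero.mp ?_)
  rw [← map_sub, d₀Inv_eq_zero_iff]
  exact (isPartialInverse_d₀Inv F k β).2

theorem weightsIn_d₀ {S : Set ℕ} {α : Form E G k} (h : 𝒱.WeightsIn S α) :
    𝒱.WeightsIn S (d₀ k α) :=
  h.algD

/-- The partial inverse of `d₀` preserves weights. -/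
theorem weightsIn_d₀Inv {S : Set ℕ} {β : Form E G (k + 1)} (h : 𝒱.WeightsIn S β) :
    𝒱.WeightsIn S (d₀Inv F k β) := by
  obtain ⟨γ, δ, hγ, hδ, hadd⟩ := exists_weightsIn_add_compl F S (d₀Inv F k β)
  obtain ⟨h1, h2⟩ := isPartialInverse_d₀Inv F k β
  -- The part `δ` with weights outside `S` vanishes: testing the projection property against `d₀ δ`
  -- gives `d₀ δ = 0`, and then `d₀⁻¹β ⊥ ker d₀` is tested against `δ`.
  suffices hz : δ = 0 by rwa [hadd, hz, add_zero]
  have hd : d₀ k δ = 0 := by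
    refine eq_zero_of_orthogonal_self F ?_
    have h3 := h2 δ
    rw [Orthogonal, pairing_sub_left, pairing_eq_zero_of_weightsIn_compl F h (weightsIn_d₀ hδ),
      hadd, map_add, pairing_add_left,
      pairing_eq_zero_of_weightsIn_compl F (weightsIn_d₀ hγ) (weightsIn_d₀ hδ), zero_add, zero_sub,
      neg_eq_zero] at h3
    exact h3
  refine eq_zero_of_orthogonal_self F ?_
  have h3 := h1 δ hd
  rwa [Orthogonal, hadd, pairing_add_left, pairing_eq_zero_of_weightsIn_compl F hγ hδ,
    zero_add] at h3

/-- The part `d - d₀` of the exterior derivative increases weights. -/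
theorem weightsIn_d_sub_d₀ {m : ℕ} {α : Form E G k} (h : 𝒱.WeightsIn (Set.Ici m) α) :
    𝒱.WeightsIn (Set.Ici (m + 1)) (d k α - d₀ k α) := by
  intro i v hv hi
  rw [AlternatingMap.sub_apply, d_apply, add_sub_cancel_right]
  refine Finset.sum_eq_zero fun a _ => ?_
  rw [h (a.removeNth i) (a.removeNth v) (fun c => hv _), map_zero, smul_zero]
  rw [Fin.sum_univ_succAbove _ a] at hi
  -- Total weight at most `m` drops below `m` once the differentiating vector, of weight at least
  -- `1`, is removed.
  have hw := 𝒱.weight_pos (i a)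
  simp only [Set.mem_Ici, Fin.removeNth] at hi ⊢
  omega

theorem weightsIn_b {m : ℕ} {α : Form E G k} (h : 𝒱.WeightsIn (Set.Ici m) α) :
    𝒱.WeightsIn (Set.Ici (m + 1)) (b F k α) := by
  have : b F k α = d₀Inv F k (-(d k α - d₀ k α)) := by
    rw [neg_sub, map_sub]
    rfl
  rw [this]
  exact weightsIn_d₀Inv F (weightsIn_d_sub_d₀ h).neg

theorem isNilpotent_b : IsNilpotent (b F k) := by
  have h : ∀ (m : ℕ) (α : Form E G k), 𝒱.WeightsIn (Set.Ici m) ((b F k ^ m) α) := by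
    intro m α
    induction m with
    | zero => exact fun i v _ hi => absurd (Nat.zero_le _) hi
    | succ m ih =>
      rw [pow_succ']
      exact weightsIn_b F ih
  refine ⟨k * (∑ j, 𝒱.weight j) + 1, ?_⟩
  ext1 α
  exact (h _ α).eq_zero F fun i hi => absurd (WeightsIn.sum_weight_lt k i) (not_lt.mpr hi)

/-- `Ring.inverse` is `0` at non-units; nilpotency of `b` makes it a genuine inverse here. -/
theorem one_sub_b_invOneSubB (α : Form E G k) :
    invOneSubB F k α - b F k (invOneSubB F k α) = α :=
  have hu : IsUnit (1 - b F k) :=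
    IsNilpotent.isUnit_one_sub (R := Module.End ℝ (Form E G k)) (isNilpotent_b F)
  LinearMap.congr_fun (show (1 - b F k) * invOneSubB F k = 1 from Ring.mul_inverse_cancel _ hu) α

theorem PiE_apply_of_mem_E₀ {α : Form E G k} (hα : α ∈ E₀ F k) :
    PiE F k α = α - invOneSubB F k (d₀Inv F k (d k α)) := by
  cases k with
  | zero => rfl
  | succ k =>
    have h : d₀Inv F k α = 0 := (d₀Inv_eq_zero_iff F α).mpr fun γ => hα.2 _ ⟨γ, rfl⟩
    change α - (invOneSubB F (k + 1) (d₀Inv F (k + 1) (d (k + 1) α)) +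
      d k (invOneSubB F k (d₀Inv F k α))) = _
    rw [h, map_zero, map_zero, add_zero]

/-- For `x = (Id - b)⁻¹ d₀⁻¹ β` one has `x - d₀⁻¹ d₀ x + d₀⁻¹ d x = d₀⁻¹ β`. Hence `x ∈ Im d₀⁻¹`,
where `d₀⁻¹ d₀` is the identity, and the first two terms cancel. -/
theorem d₀Inv_d_invOneSubB_d₀Inv (β : Form E G (k + 1)) :
    d₀Inv F k (d k (invOneSubB F k (d₀Inv F k β))) = d₀Inv F k β := by
  have h := one_sub_b_invOneSubB F (d₀Inv F k β)
  set x := invOneSubB F k (d₀Inv F k β)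
  have hb : b F k x = d₀Inv F k (d₀ k x) - d₀Inv F k (d k x) := rfl
  rw [hb] at h
  have hx : x = d₀Inv F k (β + d₀ k x - d k x) := by
    rw [map_sub, map_add]
    nth_rw 1 [← h]
    abel
  have hx' : d₀Inv F k (d₀ k x) = x := by
    rw [hx, d₀Inv_d₀_d₀Inv]
  rw [hx'] at h
  rw [← h]
  abel

/-- `d Π_E α` is orthogonal to `Im d₀`. -/
theorem d₀Inv_d_PiE {α : Form E G k} (hα : α ∈ E₀ F k) :
    d₀Inv F k (d k (PiE F k α)) = 0 := by
  rw [PiE_apply_of_mem_E₀ F hα, map_sub, map_sub, d₀Inv_d_invOneSubB_d₀Inv, sub_self]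

theorem PiE_eq_self_of_isGreatest {p : ℕ} {α : Form E G k} (hα : α ∈ E₀ F k)
    (hp : 𝒱.HasWeight p α)
    (hmax : IsGreatest {q : ℕ | ∃ β : Form E G k, β ≠ 0 ∧ 𝒱.HasWeight q β} p) :
    PiE F k α = α := by
  have hd : 𝒱.WeightsIn (Set.Ici (p + 1)) (d₀Inv F k (d k α)) := by
    have h := weightsIn_d_sub_d₀ (WeightsIn.mono (hasWeight_iff_weightsIn.mp hp)
      (Set.singleton_subset_iff.mpr (Set.mem_Ici.mpr le_rfl)))
    rw [hα.1, sub_zero] at h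
    exact weightsIn_d₀Inv F h
  have hz : d₀Inv F k (d k α) = 0 := by
    refine eq_of_forall_homogeneous F fun i v hv => ?_
    by_cases hi : ∑ a, 𝒱.weight (i a) ∈ Set.Ici (p + 1)
    · set q := ∑ a, 𝒱.weight (i a)
      -- A nonzero component would be a form of pure weight `q > p`, against maximality.
      have hc : 𝒱.component q (d₀Inv F k (d k α)) = 0 := by
        by_contra hne
        exact absurd (hmax.2 ⟨_, hne, weightsIn_component q _⟩) (not_le.mpr hi)
      rw [← hc, component_apply_of_mem q _ i v hv, if_pos rfl]
    · exact hd i v hv hi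
  rw [PiE_apply_of_mem_E₀ F hα, hz, map_zero, sub_zero]

/-- The lowest component of a closed form in `ker d₀⁻¹` is a Rumin form. -/
theorem component_mem_E₀ {q : ℕ} {β : Form E G (k + 1)} (hd : d (k + 1) β = 0)
    (hβ : d₀Inv F k β = 0) (hq : 𝒱.WeightsIn (Set.Ici q) β) :
    𝒱.component q β ∈ E₀ F (k + 1) := by
  have hc := weightsIn_component (𝒱 := 𝒱) q β
  have hr := hq.sub_component
  refine ⟨?_, ?_⟩
  · have h1 : 𝒱.WeightsIn (Set.Ici (q + 1)) (d₀ (k + 1) (𝒱.component q β)) := by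
      -- Since `dβ = 0`, `d₀(β)_q` is minus the sum of `(d - d₀)β` and `d₀(β - (β)_q)`, both of
      -- weight above `q`; yet it also has weight `q`.
      have h2 := ((weightsIn_d_sub_d₀ hq).add (weightsIn_d₀ hr)).neg
      have h3 : -(d (k + 1) β - d₀ (k + 1) β + d₀ (k + 1) (β - 𝒱.component q β)) =
          d₀ (k + 1) (𝒱.component q β) := by
        rw [hd, map_sub]
        abel
      rwa [h3] at h2
    refine ((weightsIn_d₀ hc).inter h1).eq_zero F fun i hi => ?_
    have h4 : _ = q := hi.1
    have h5 : q + 1 ≤ _ := hi.2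
    omega
  · rintro _ ⟨γ, rfl⟩
    -- Against `d₀γ₁`, of weight `q`, the forms `(β)_q` and `β` have the same product, which is
    -- zero; `d₀γ₂` has no part of weight `q`.
    obtain ⟨γ₁, γ₂, h₁, h₂, rfl⟩ := exists_weightsIn_add_compl F {q} γ
    have h3 : 𝒱.WeightsIn ({q} : Set ℕ)ᶜ (β - 𝒱.component q β) :=
      hr.mono fun x hx => by
        have : q + 1 ≤ x := hx
        simp only [Set.mem_compl_iff, Set.mem_singleton_iff]
        omega
    have h4 : pairing F.X (β - 𝒱.component q β) (d₀ k γ₁) = 0 := by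
      rw [pairing_comm]
      exact pairing_eq_zero_of_weightsIn_compl F (weightsIn_d₀ h₁) h3
    rw [pairing_sub_left, (d₀Inv_eq_zero_iff F β).mp hβ γ₁, zero_sub, neg_eq_zero] at h4
    rw [Orthogonal, map_add, pairing_add_right, h4,
      pairing_eq_zero_of_weightsIn_compl F hc (weightsIn_d₀ h₂), add_zero]

end Forms

end Rumin

end

/-- Let `𝔾 = G` be a connected, simply connected Lie group whose Lie algebra is positively graded
by `𝒱`, with an adapted scalar product `sp` (computed in any adapted orthonormal basis `F`), and
let `α ∈ E₀^k` be a Rumin form of pure weight `p`.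
(1) If `p` is the maximal weight of (nonzero) `k`-forms, then `Π_E α = α`.
(2) If `dΠ_E α` is the sum of its components of weights `q₀ < q₁ < ⋯ < q_m`, then the lowest one,
`(dΠ_E α)_{q₀}`, belongs to `E₀^{k+1}`. -/
theorem mainTheorem9 {E : Type*} [NormedAddCommGroup E] [NormedSpace ℝ E] [FiniteDimensional ℝ E]
    {G : Type*} [TopologicalSpace G] [ChartedSpace E G] [Group G] [LieGroup 𝓘(ℝ, E) ∞ G]
    [SimplyConnectedSpace G]
    (𝒱 : Rumin.PositiveGrading (Rumin.LieAlg E G)) (sp : Rumin.AdaptedScalarProduct 𝒱)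
    {n : ℕ} (F : Rumin.GradedOrthonormalBasis sp n) (k p : ℕ) (α : Rumin.Form E G k)
    (hα : α ∈ Rumin.E₀ F k) (hp : 𝒱.HasWeight p α) :
    (IsGreatest {q : ℕ | ∃ β : Rumin.Form E G k, β ≠ 0 ∧ 𝒱.HasWeight q β} p →
      Rumin.PiE F k α = α) ∧
    (∀ (m : ℕ) (q : Fin (m + 1) → ℕ), StrictMono q →
      Rumin.d k (Rumin.PiE F k α) =
        ∑ i, 𝒱.component (q i) (Rumin.d k (Rumin.PiE F k α)) →
      𝒱.component (q 0) (Rumin.d k (Rumin.PiE F k α)) ∈ Rumin.E₀ F (k + 1)) := by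
  refine ⟨Rumin.PiE_eq_self_of_isGreatest F hα hp, fun m q hq hsum => ?_⟩
  refine Rumin.component_mem_E₀ F (Rumin.d_d _) (Rumin.d₀Inv_d_PiE F hα) ?_
  rw [hsum]
  -- `q 0` bounds all occurring weights from below; its component may be zero.
  refine Rumin.PositiveGrading.WeightsIn.sum _ fun i _ =>
    (Rumin.PositiveGrading.weightsIn_component (q i) _).mono ?_
  exact Set.singleton_subset_iff.mpr (hq.monotone (Fin.zero_le i))
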